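/- Let $0\le \ell\le n$ be integers. A literal is one of the variables $x_1,\dots,x_n$ or its negation; a clause is a disjunction of exactly $\ell$ literals in which no variable appears twice; an $\ell$-CNF formula is a conjunction of one or more clauses, none duplicated (clauses and formulae are regarded up to the order of their literals and clauses). For formulae $\phi,\psi$ write $\phi\Rightarrow\psi$ if every truth assignment satisfying $\phi$ satisfies $\psi$. Let $|\ell\text{-}SAT\text{-}n|$ be (the geometric realization of) the simplicial complex whose vertices are the satisfiable $\ell$-CNF formulae in $x_1,\dots,x_n$, and in which a nonempty finite set of vertices is a simplex if and only if its elements can be listed as a chain of implications $\phi_0\Rightarrow\phi_1\Rightarrow\cdots\Rightarrow\phi_k$. Let $\operatorname{Cube}(n,k)$ be the hypergraph whose vertices are the vertices of the $n$-cube and whose hyperedges are the sets of vertices spanning $k$-dimensional faces of the $n$-cube. For a hypergraph $\mathcal H$ let $\Theta(\mathcal H)$ be (the geometric realization of) the simplicial complex whose simplices are the nonempty finite sets of vertices contained in the complement of at least one hyperedge of $\mathcal H$. **Theorem.** There is a homotopy equivalence $$|\ell\text{-}SAT\text{-}n|\simeq \Theta(\operatorname{Cube}(n,n-\ell)).$$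 -/

import Mathlib

open scoped ContinuousMap

/-- The geometric realization of a simplicial complex `K` with finitely many vertices: all
barycentric coordinate vectors `x : V → ℝ` whose support is contained in a face of `K`. It is used
as a topological space, with the subspace topology from the finite-dimensional space `V → ℝ`. -/
def geometricRealization {V : Type*} [Fintype V] (K : PreAbstractSimplicialComplex V) :
    Set (V → ℝ) :=
  {x | x ∈ stdSimplex ℝ V ∧ ∃ s ∈ K.faces, ∀ v, x v ≠ 0 → v ∈ s}

/-! ### Theta complexes of hypergraphs -/

/-- The theta complex `Θ(H)` of a hypergraph `H`: the simplices are spanned by the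
(nonempty) finite sets of vertices contained in the complement of some hyperedge. -/
def thetaComplex {V : Type*} (H : Hypergraph V) : PreAbstractSimplicialComplex V where
  faces := {s | s.Nonempty ∧ ∃ e ∈ H.edgeSet, (s : Set V) ⊆ H.vertexSet \ e}
  isRelLowerSet_faces := by
    rintro s ⟨hs, e, he, hse⟩
    refine ⟨hs, fun t hts ht => ⟨ht, e, he, ?_⟩⟩
    exact (Finset.coe_subset.2 hts).trans hse

/-- The face of the `n`-cube through the vertex `a` whose free coordinates are those in `I`,
given by its set of vertices. Its dimension is the number of free coordinates. -/
def cubeFace {n : ℕ} (I : Finset (Fin n)) (a : Fin n → Bool) : Set (Fin n → Bool) :=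
  {v | ∀ i, i ∉ I → v i = a i}

/-- The hypergraph `Cube(n, k)`: its vertices are the vertices of the `n`-cube and its hyperedges
are the vertex sets of the `k`-dimensional faces of the `n`-cube. -/
def cubeHypergraph (n k : ℕ) : Hypergraph (Fin n → Bool) where
  vertexSet := Set.univ
  edgeSet := {F | ∃ (I : Finset (Fin n)) (a : Fin n → Bool), I.card = k ∧ F = cubeFace I a}
  subset_vertexSet_of_mem_edgeSet' := fun _ _ => Set.subset_univ _

/-! ### Boolean formulae -/

/-- A literal in the variables `x₁, …, xₙ`: the pair `(i, true)` stands for the variable `xᵢ`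
and the pair `(i, false)` for its negation. -/
abbrev BoolLiteral (n : ℕ) : Type := Fin n × Bool

/-- A set of literals, read as their disjunction. -/
abbrev BoolClause (n : ℕ) : Type := Finset (BoolLiteral n)

/-- A set of clauses (so without duplicates), read as their conjunction. -/
abbrev BoolFormula (n : ℕ) : Type := Finset (BoolClause n)

namespace BoolFormula

/-- The truth assignment `τ` satisfies `φ`: every clause of `φ` contains a literal that is true
under `τ`. -/
def SatisfiedBy {n : ℕ} (φ : BoolFormula n) (τ : Fin n → Bool) : Prop :=
  ∀ c ∈ φ, ∃ L ∈ c, τ L.1 = L.2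

/-- `φ` has at least one satisfying truth assignment. -/
def Satisfiable {n : ℕ} (φ : BoolFormula n) : Prop :=
  ∃ τ, φ.SatisfiedBy τ

/-- Logical implication `φ ⇒ ψ`. -/
def Implies {n : ℕ} (φ ψ : BoolFormula n) : Prop :=
  ∀ τ, φ.SatisfiedBy τ → ψ.SatisfiedBy τ

/-- `φ` is in `ℓ`-conjunctive normal form: it is a conjunction of at least one clause, every clause
contains exactly `ℓ` literals, and no variable appears twice in a clause. -/
def IsCNF {n : ℕ} (ℓ : ℕ) (φ : BoolFormula n) : Prop :=
  φ.Nonempty ∧ ∀ c ∈ φ, c.card = ℓ ∧ ∀ L ∈ c, ∀ M ∈ c, L.1 = M.1 → L = M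

end BoolFormula

/-- The set `ℓ-SAT-n` of satisfiable formulae in `ℓ`-conjunctive normal form in the variables
`x₁, …, xₙ`. -/
abbrev SatFormula (ℓ n : ℕ) : Type :=
  {φ : BoolFormula n // φ.IsCNF ℓ ∧ φ.Satisfiable}

noncomputable instance instFintypeSatFormula (ℓ n : ℕ) : Fintype (SatFormula ℓ n) :=
  Fintype.ofFinite _

/-- The simplicial complex with vertex set `ℓ-SAT-n`, in which a nonempty finite set of formulae is
a simplex if and only if its elements can be listed as a chain of implications
`φ₀ ⇒ φ₁ ⇒ ⋯ ⇒ φₖ`. -/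
def satComplex (ℓ n : ℕ) : AbstractSimplicialComplex (SatFormula ℓ n) where
  faces := {s | s.Nonempty ∧ ∃ l : List (SatFormula ℓ n),
    (∀ φ, φ ∈ l ↔ φ ∈ s) ∧ l.IsChain (fun φ ψ => φ.1.Implies ψ.1)}
  isRelLowerSet_faces := by
    classical
    rintro s ⟨hs, l, hl, hc⟩
    refine ⟨hs, fun t hts ht => ⟨ht, l.filter (· ∈ t), fun φ => ?_, ?_⟩⟩
    · simp only [List.mem_filter, hl, decide_eq_true_eq]
      exact ⟨fun h => h.2, fun h => ⟨hts h, h⟩⟩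
    · have : IsTrans (SatFormula ℓ n) (fun φ ψ => φ.1.Implies ψ.1) :=
        ⟨fun _ _ _ h₁ h₂ τ h => h₂ τ (h₁ τ h)⟩
      exact ((List.isChain_iff_pairwise.1 hc).filter _).isChain
  singleton_mem φ := ⟨Finset.singleton_nonempty φ, [φ], by simp, by simp⟩

/-! An `ℓ`-clause is falsified exactly on an `(n - ℓ)`-face of the cube, so the model sets of
satisfiable `ℓ`-CNF formulae are the nonempty intersections of complements of such faces. All of
these are simplices of `Θ`. Sending a simplex `σ` to the models of the strongest `ℓ`-CNF formula
true on `σ` is a closure operator on the simplices of `Θ`, with these model sets as its closed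
elements. A closure operator does not change the homotopy type of the order complex, and the order
complex of all simplices is the barycentric subdivision of `Θ`.

`nonempty_homotopyEquiv_of_hull` makes this explicit. One map replaces each formula by the indicator
function of its models; the other spreads a point over its superlevel sets, which form a chain, and
takes hulls. Both composites are contiguous to the identity. Equivalent formulae are distinct
vertices, so `S` need not be injective. -/

/-- The straight-line homotopy between two maps into a geometric realization which send each point
into a common simplex. -/
theorem homotopic_of_contiguous {X V : Type*} [TopologicalSpace X] [Fintype V]
    {K : PreAbstractSimplicialComplex V} (f g : C(X, geometricRealization K))
    (h : ∀ x, ∃ s ∈ K.faces, (∀ v, (f x).1 v ≠ 0 → v ∈ s) ∧ ∀ v, (g x).1 v ≠ 0 → v ∈ s) :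
    f.Homotopic g := by
  refine ⟨⟨⟨fun p => ⟨(1 - (p.1 : ℝ)) • (f p.2).1 + (p.1 : ℝ) • (g p.2).1, ?_, ?_⟩, ?_⟩, ?_, ?_⟩⟩
  · exact convex_stdSimplex ℝ V (f p.2).2.1 (g p.2).2.1 (by linarith [p.1.2.2]) p.1.2.1 (by ring)
  · obtain ⟨s, hs, hf, hg⟩ := h p.2
    refine ⟨s, hs, fun v hv => ?_⟩
    by_contra hvs
    have h₁ : (f p.2).1 v = 0 := by_contra fun h => hvs (hf v h)
    have h₂ : (g p.2).1 v = 0 := by_contra fun h => hvs (hg v h)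
    simp [h₁, h₂] at hv
  · fun_prop
  · intro x
    ext
    simp
  · intro x
    ext
    simp

/-- A continuous family of nonnegative, nonzero vectors, each supported on a simplex, rescaled to
a map into the geometric realization. -/
noncomputable def normalizedMap {X V : Type*} [TopologicalSpace X] [Fintype V]
    {K : PreAbstractSimplicialComplex V} (u : X → V → ℝ) (hc : Continuous u)
    (h0 : ∀ x v, 0 ≤ u x v) (hpos : ∀ x, 0 < ∑ v, u x v)
    (hs : ∀ x, ∃ s ∈ K.faces, ∀ v, u x v ≠ 0 → v ∈ s) : C(X, geometricRealization K) where
  toFun x := ⟨fun v => u x v / ∑ w, u x w,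
    ⟨fun v => div_nonneg (h0 x v) (hpos x).le, by
      rw [← Finset.sum_div, div_self (hpos x).ne']⟩, by
      obtain ⟨s, hs, h⟩ := hs x
      exact ⟨s, hs, fun v hv => h v fun h => hv (by simp [h])⟩⟩
  continuous_toFun := by
    refine Continuous.subtype_mk (continuous_pi fun v => ?_) _
    exact Continuous.div (by fun_prop) (by fun_prop) fun x => (hpos x).ne'

/-- The weight of `s` at `y`: it is nonzero exactly if `s` is a strict superlevel set of `y` on
which `y` is positive. -/
noncomputable def superlevelWeight {V : Type*} [Fintype V] [DecidableEq V] (s : Finset V)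
    (y : V → ℝ) : ℝ :=
  (∏ v ∈ s, ∏ w ∈ sᶜ, max 0 (y v - y w)) * ∏ v ∈ s, max 0 (y v)

section superlevelWeight

variable {V : Type*} [Fintype V] [DecidableEq V]

theorem superlevelWeight_nonneg (s : Finset V) (y : V → ℝ) : 0 ≤ superlevelWeight s y :=
  mul_nonneg (Finset.prod_nonneg fun _ _ => Finset.prod_nonneg fun _ _ => le_max_left _ _)
    (Finset.prod_nonneg fun _ _ => le_max_left _ _)

theorem continuous_superlevelWeight (s : Finset V) : Continuous (superlevelWeight s) := by
  unfold superlevelWeight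
  fun_prop

theorem superlevelWeight_ne_zero_iff {s : Finset V} {y : V → ℝ} :
    superlevelWeight s y ≠ 0 ↔ (∀ v ∈ s, ∀ w ∉ s, y w < y v) ∧ ∀ v ∈ s, 0 < y v := by
  have h (a : ℝ) : max 0 a ≠ 0 ↔ 0 < a := by
    constructor
    · exact fun h => lt_of_not_ge fun h' => h (max_eq_left h')
    · exact fun h => (lt_max_of_lt_right h).ne'
  simp only [superlevelWeight, mul_ne_zero_iff, Finset.prod_ne_zero_iff, h, sub_pos,
    Finset.mem_compl]

end superlevelWeight

/-! ### Closure operators on the faces of a complex -/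

/-- If a family of faces `S p` of `K` is such that every face `σ` has a hull `S (g σ) ⊇ σ`, where
hulls are monotone and `S p` is its own hull, then the complex of chains of the family is homotopy
equivalent to `K`. -/
theorem nonempty_homotopyEquiv_of_hull {V P : Type*} [Fintype V] [Fintype P]
    (K : PreAbstractSimplicialComplex V) (L : PreAbstractSimplicialComplex P) (S : P → Finset V)
    (hL : ∀ s, s ∈ L.faces ↔ s.Nonempty ∧ ∀ p ∈ s, ∀ q ∈ s, S p ⊆ S q ∨ S q ⊆ S p)
    (hS : ∀ p, S p ∈ K.faces) (g : K.faces → P)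
    (hmono : ∀ σ τ : K.faces, σ.1 ⊆ τ.1 → S (g σ) ⊆ S (g τ))
    (hle : ∀ σ : K.faces, σ.1 ⊆ S (g σ)) (hSg : ∀ p, S (g ⟨S p, hS p⟩) = S p) :
    Nonempty (geometricRealization L ≃ₕ geometricRealization K) := by
  classical
  have hK {s : Finset V} (hs : s ∈ K.faces) : s.Nonempty := (K.isRelLowerSet_faces hs).1
  have hKs {s t : Finset V} (hs : s ∈ K.faces) (hts : t ⊆ s) (ht : t.Nonempty) : t ∈ K.faces :=
    (K.isRelLowerSet_faces hs).2 hts ht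
  have : Fintype K.faces := Fintype.ofFinite _
  -- supports of points
  have suppK (y : geometricRealization K) : Finset.univ.filter (fun v => y.1 v ≠ 0) ∈ K.faces := by
    obtain ⟨y, ⟨-, hy1⟩, s, hs, h⟩ := y
    refine hKs hs (fun v hv => h v (Finset.mem_filter.1 hv).2) ?_
    obtain ⟨v, -, hv⟩ := Finset.exists_ne_zero_of_sum_ne_zero (s := Finset.univ) (f := y)
      (by rw [hy1]; exact one_ne_zero)
    exact ⟨v, by simpa using hv⟩
  have suppL (x : geometricRealization L) : (∃ p, x.1 p ≠ 0) ∧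
      ∀ p q, x.1 p ≠ 0 → x.1 q ≠ 0 → S p ⊆ S q ∨ S q ⊆ S p := by
    obtain ⟨x, ⟨-, hx1⟩, s, hs, h⟩ := x
    refine ⟨?_, fun p q hp hq => ((hL s).1 hs).2 p (h p hp) q (h q hq)⟩
    obtain ⟨p, -, hp⟩ := Finset.exists_ne_zero_of_sum_ne_zero (s := Finset.univ) (f := x)
      (by rw [hx1]; exact one_ne_zero)
    exact ⟨p, hp⟩
  -- the map towards `K`
  let u (x : geometricRealization L) (v : V) : ℝ := ∑ p, if v ∈ S p then x.1 p else 0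
  have x0 (x : geometricRealization L) (p : P) : 0 ≤ x.1 p := x.2.1.1 p
  have u_le (x) (v w) (h : ∀ p, x.1 p ≠ 0 → v ∈ S p → w ∈ S p) : u x v ≤ u x w := by
    refine Finset.sum_le_sum fun p _ => ?_
    have := x0 x p
    have := h p
    split_ifs <;> grind
  have u0 (x v) : 0 ≤ u x v := Finset.sum_nonneg fun p _ => by
    split_ifs
    exacts [x0 x p, le_rfl]
  have u_ne (x v) : u x v ≠ 0 ↔ ∃ p, x.1 p ≠ 0 ∧ v ∈ S p := by
    rw [Ne, Finset.sum_eq_zero_iff_of_nonneg (fun p _ => by split_ifs; exacts [x0 x p, le_rfl])]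
    simp [and_comm]
  have u_pos (x) : 0 < ∑ v, u x v := by
    obtain ⟨p, hp⟩ := (suppL x).1
    obtain ⟨v, hv⟩ := hK (hS p)
    exact Finset.sum_pos' (fun v _ => u0 x v)
      ⟨v, Finset.mem_univ _, (u0 x v).lt_of_ne' ((u_ne x v).2 ⟨p, hp, hv⟩)⟩
  have u_supp (x) : ∃ s ∈ K.faces, ∀ v, u x v ≠ 0 → v ∈ s := by
    obtain ⟨⟨p, hp⟩, hx⟩ := suppL x
    -- The largest `S q` over the support of `x` is the top of the chain, so it contains all the
    -- others.
    obtain ⟨q, hq, hmax⟩ := Finset.exists_max_image (Finset.univ.filter fun p => x.1 p ≠ 0)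
      (fun p => (S p).card) ⟨p, by simpa using hp⟩
    refine ⟨S q, hS q, fun v hv => ?_⟩
    obtain ⟨p, hp, hvp⟩ := (u_ne x v).1 hv
    rcases hx p q hp (by simpa using hq) with h | h
    · exact h hvp
    · exact (Finset.eq_of_subset_of_card_le h (hmax p (by simpa using hp))) ▸ hvp
  have u_cont : Continuous u := by
    refine continuous_pi fun v => continuous_finsetSum _ fun p _ => ?_
    split_ifs
    · exact (continuous_apply p).comp continuous_subtype_val
    · exact continuous_const
  let F : C(geometricRealization L, geometricRealization K) :=
    normalizedMap u u_cont u0 u_pos u_supp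
  have F_def (x v) : (F x).1 v = u x v / ∑ w, u x w := rfl
  have F_ne (x v) : (F x).1 v ≠ 0 ↔ ∃ p, x.1 p ≠ 0 ∧ v ∈ S p := by
    rw [F_def, div_ne_zero_iff, u_ne]
    exact and_iff_left (u_pos x).ne'
  -- the map towards `L`
  let d (y : geometricRealization K) (p : P) : ℝ :=
    ∑ σ : K.faces, if g σ = p then superlevelWeight σ.1 y.1 else 0
  have d0 (y p) : 0 ≤ d y p := Finset.sum_nonneg fun σ _ => by
    split_ifs
    exacts [superlevelWeight_nonneg _ _, le_rfl]
  have d_ne (y p) : d y p ≠ 0 ↔ ∃ σ, g σ = p ∧ superlevelWeight σ.1 y.1 ≠ 0 := by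
    rw [Ne, Finset.sum_eq_zero_iff_of_nonneg
      (fun p _ => by split_ifs; exacts [superlevelWeight_nonneg _ _, le_rfl])]
    simp
  have d_pos (y) : 0 < ∑ p, d y p := by
    -- The support of `y` is itself a strict superlevel set, so some weight is positive.
    refine Finset.sum_pos' (fun p _ => d0 y p) ⟨g ⟨_, suppK y⟩, Finset.mem_univ _,
      (d0 y _).lt_of_ne' ((d_ne y _).2 ⟨_, rfl, superlevelWeight_ne_zero_iff.2 ⟨?_, ?_⟩⟩)⟩
    · intro v hv w hw
      simp only [Finset.mem_filter, Finset.mem_univ, true_and, not_not] at hv hw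
      exact hw ▸ (y.2.1.1 v).lt_of_ne' hv
    · intro v hv
      exact (y.2.1.1 v).lt_of_ne' (by simpa using hv)
  have d_supp (y) : ∃ s ∈ L.faces, ∀ p, d y p ≠ 0 → p ∈ s := by
    refine ⟨Finset.univ.filter fun p => d y p ≠ 0, (hL _).2 ⟨?_, ?_⟩, fun p hp => by simpa using hp⟩
    · obtain ⟨p, -, hp⟩ := Finset.exists_ne_zero_of_sum_ne_zero (d_pos y).ne'
      exact ⟨p, by simpa using hp⟩
    · intro p hp q hq
      simp only [Finset.mem_filter, Finset.mem_univ, true_and, d_ne,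
        superlevelWeight_ne_zero_iff] at hp hq
      obtain ⟨σ, rfl, hσ, -⟩ := hp
      obtain ⟨τ, rfl, hτ, -⟩ := hq
      -- Strict superlevel sets are nested: `v ∈ σ \ τ` and `w ∈ τ \ σ` would give `y w < y v < y
      -- w`.
      by_cases h : σ.1 ⊆ τ.1
      · exact Or.inl (hmono _ _ h)
      · obtain ⟨v, hv, hv'⟩ := Finset.not_subset.1 h
        refine Or.inr (hmono _ _ fun w hw => by_contra fun hw' => ?_)
        exact lt_asymm (hσ v hv w hw') (hτ w hw v hv')
  have d_cont : Continuous d := by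
    refine continuous_pi fun p => continuous_finsetSum _ fun σ _ => ?_
    split_ifs
    · exact (continuous_superlevelWeight _).comp continuous_subtype_val
    · fun_prop
  let G : C(geometricRealization K, geometricRealization L) :=
    normalizedMap d d_cont d0 d_pos d_supp
  have G_ne (y p) : (G y).1 p ≠ 0 ↔ ∃ σ, g σ = p ∧ superlevelWeight σ.1 y.1 ≠ 0 := by
    rw [show (G y).1 p = d y p / ∑ w, d y w from rfl, div_ne_zero_iff, d_ne]
    exact and_iff_left (d_pos y).ne'
  -- superlevel sets of `F x` belong to the support of `x`
  have key (x) (σ : K.faces) (h : superlevelWeight σ.1 (F x).1 ≠ 0) :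
      ∃ p, x.1 p ≠ 0 ∧ S p = σ.1 := by
    obtain ⟨hσ, hσ0⟩ := superlevelWeight_ne_zero_iff.1 h
    have hσ (v) (hv : v ∈ σ.1) (w) (hw : w ∉ σ.1) : u x w < u x v :=
      (div_lt_div_iff_of_pos_right (u_pos x)).1 (hσ v hv w hw)
    -- With `v` a lowest point of `σ`, the smallest chain member containing `v` must be `σ`.
    obtain ⟨v, hv, hvmin⟩ := Finset.exists_min_image σ.1 (u x) (hK σ.2)
    obtain ⟨p₀, hp₀, hvp₀⟩ := (F_ne x v).1 (hσ0 v hv).ne'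
    obtain ⟨p, hp, hpmin⟩ := Finset.exists_min_image
      (Finset.univ.filter fun p => x.1 p ≠ 0 ∧ v ∈ S p)
      (fun p => (S p).card) ⟨p₀, by simp [hp₀, hvp₀]⟩
    simp only [Finset.mem_filter, Finset.mem_univ, true_and] at hp hpmin
    have hx := (suppL x).2
    refine ⟨p, hp.1, Finset.Subset.antisymm (fun w hw => by_contra fun hwσ => ?_)
      fun w hw => by_contra fun hwp => ?_⟩
    · refine (hσ v hv w hwσ).not_ge (u_le x v w fun q hq hvq => ?_)
      rcases hx p q hp.1 hq with h | h
      · exact h hw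
      · exact (Finset.eq_of_subset_of_card_le h (hpmin q ⟨hq, hvq⟩)) ▸ hw
    · refine (hvmin w hw).not_gt (Finset.sum_lt_sum (fun q _ => ?_) ⟨p, Finset.mem_univ _, ?_⟩)
      · have := x0 x q
        have h' : x.1 q ≠ 0 → w ∈ S q → v ∈ S q := fun hq hwq =>
          (hx p q hp.1 hq).elim (fun h => h hp.2) fun h => absurd (h hwq) hwp
        split_ifs <;> grind
      · simpa [hwp, hp.2] using (x0 x p).lt_of_ne' hp.1
  refine ⟨⟨F, G, homotopic_of_contiguous _ _ fun x => ?_,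
    homotopic_of_contiguous _ _ fun y => ?_⟩⟩
  · have hGF (p) (hp : (G (F x)).1 p ≠ 0) : ∃ q, x.1 q ≠ 0 ∧ S p = S q := by
      obtain ⟨σ, rfl, hσ⟩ := (G_ne _ _).1 hp
      obtain ⟨q, hq, hqσ⟩ := key x σ hσ
      obtain rfl : σ = ⟨S q, hS q⟩ := Subtype.ext hqσ.symm
      exact ⟨q, hq, hSg q⟩
    -- `G ∘ F` may move weight to another index with the same `S`, so the common simplex must
    -- include all of these.
    refine ⟨Finset.univ.filter fun p => ∃ q, x.1 q ≠ 0 ∧ S p = S q, (hL _).2 ⟨?_, ?_⟩, ?_, ?_⟩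
    · obtain ⟨p, hp⟩ := (suppL x).1
      exact ⟨p, by simpa using ⟨p, hp, rfl⟩⟩
    · intro p hp q hq
      simp only [Finset.mem_filter, Finset.mem_univ, true_and] at hp hq
      obtain ⟨p', hp', hp⟩ := hp
      obtain ⟨q', hq', hq⟩ := hq
      rw [hp, hq]
      exact (suppL x).2 _ _ hp' hq'
    · exact fun p hp => by simpa using hGF p hp
    · exact fun p hp => by simpa using ⟨p, hp, rfl⟩
  -- Every superlevel set that gets weight lies in the support of `y`, so by monotonicity its hull
  -- lies in the hull of the support.
  · refine ⟨S (g ⟨_, suppK y⟩), hS _, fun v hv => ?_, fun v hv => hle _ (by simpa using hv)⟩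
    obtain ⟨p, hp, hvp⟩ := (F_ne (G y) v).1 hv
    obtain ⟨σ, rfl, hσ⟩ := (G_ne y p).1 hp
    refine hmono σ ⟨_, suppK y⟩ (fun w hw => ?_) hvp
    simpa using ((superlevelWeight_ne_zero_iff.1 hσ).2 w hw).ne'

/-! ### Formulae and their models -/

namespace BoolFormula

/-- The set of satisfying truth assignments. -/
noncomputable def models {n : ℕ} (φ : BoolFormula n) : Finset (Fin n → Bool) :=
  open Classical in Finset.univ.filter φ.SatisfiedBy

theorem mem_models {n : ℕ} {φ : BoolFormula n} {τ : Fin n → Bool} :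
    τ ∈ φ.models ↔ φ.SatisfiedBy τ := by
  simp [models]

theorem implies_iff_models_subset {n : ℕ} {φ ψ : BoolFormula n} :
    φ.Implies ψ ↔ φ.models ⊆ ψ.models := by
  simp [Implies, Finset.subset_iff, mem_models]

/-- The strongest formula in `ℓ`-conjunctive normal form which holds on `σ`: the conjunction of all
clauses which do. -/
noncomputable def strongest {n : ℕ} (ℓ : ℕ) (σ : Finset (Fin n → Bool)) : BoolFormula n :=
  open Classical in Finset.univ.filter fun c =>
    (c.card = ℓ ∧ ∀ L ∈ c, ∀ M ∈ c, L.1 = M.1 → L = M) ∧ ∀ τ ∈ σ, ∃ L ∈ c, τ L.1 = L.2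

theorem mem_strongest {n ℓ : ℕ} {σ : Finset (Fin n → Bool)} {c : BoolClause n} :
    c ∈ strongest ℓ σ ↔ (c.card = ℓ ∧ ∀ L ∈ c, ∀ M ∈ c, L.1 = M.1 → L = M) ∧
      ∀ τ ∈ σ, ∃ L ∈ c, τ L.1 = L.2 := by
  simp [strongest]

theorem subset_models_strongest {n : ℕ} (ℓ : ℕ) (σ : Finset (Fin n → Bool)) :
    σ ⊆ (strongest ℓ σ).models := fun τ hτ =>
  mem_models.2 fun _ hc => (mem_strongest.1 hc).2 τ hτ

theorem models_strongest_mono {n : ℕ} (ℓ : ℕ) {σ σ' : Finset (Fin n → Bool)} (h : σ ⊆ σ') :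
    (strongest ℓ σ).models ⊆ (strongest ℓ σ').models := fun τ hτ =>
  mem_models.2 fun c hc => mem_models.1 hτ c <| by
    rw [mem_strongest] at hc ⊢
    exact ⟨hc.1, fun τ hτ => hc.2 τ (h hτ)⟩

/-- Every clause of `φ` holds on the models of `φ`, hence occurs in the strongest formula. -/
theorem IsCNF.models_strongest {n ℓ : ℕ} {φ : BoolFormula n} (hφ : φ.IsCNF ℓ) :
    (strongest ℓ φ.models).models = φ.models :=
  (subset_models_strongest ℓ _).antisymm' fun _ hτ => mem_models.2 fun c hc =>
    mem_models.1 hτ c (mem_strongest.2 ⟨hφ.2 c hc, fun _ h => mem_models.1 h c hc⟩)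

end BoolFormula

open BoolFormula

/-! ### Clauses as faces of the cube -/

/-- The assignments falsifying a clause form a face of the cube. -/
theorem exists_cubeFace_of_clause {n ℓ : ℕ} {c : BoolClause n} (hcard : c.card = ℓ)
    (hc : ∀ L ∈ c, ∀ M ∈ c, L.1 = M.1 → L = M) :
    ∃ (I : Finset (Fin n)) (a : Fin n → Bool), I.card = n - ℓ ∧
      ∀ τ, τ ∉ cubeFace I a ↔ ∃ L ∈ c, τ L.1 = L.2 := by
  classical
  -- On the variables of `c`, the base point makes each literal false; its other values are
  -- irrelevant, being free coordinates.
  refine ⟨(c.image Prod.fst)ᶜ, fun i => decide ((i, false) ∈ c), ?_, fun τ => ?_⟩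
  · rw [Finset.card_compl, Fintype.card_fin,
      Finset.card_image_of_injOn (fun L hL M hM => hc L hL M hM), hcard]
  · simp only [cubeFace, Set.mem_ofPred_eq, Finset.mem_compl, not_not, not_forall]
    constructor
    · rintro ⟨i, hi, h⟩
      obtain ⟨⟨j, b⟩, hL, rfl⟩ := Finset.mem_image.1 hi
      refine ⟨_, hL, ?_⟩
      have := hc _ hL (j, false)
      cases b <;> cases hτ : τ j <;> simp_all
    · rintro ⟨⟨j, b⟩, hL, h⟩
      refine ⟨j, Finset.mem_image.2 ⟨_, hL, rfl⟩, ?_⟩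
      have := hc _ hL (j, false)
      cases b <;> simp_all

/-- Every face of the cube is the set of assignments falsifying some clause. -/
theorem exists_clause_of_cubeFace {n ℓ : ℕ} (hℓn : ℓ ≤ n) {I : Finset (Fin n)}
    (hI : I.card = n - ℓ) (a : Fin n → Bool) :
    ∃ c : BoolClause n, (c.card = ℓ ∧ ∀ L ∈ c, ∀ M ∈ c, L.1 = M.1 → L = M) ∧
      ∀ τ, τ ∉ cubeFace I a ↔ ∃ L ∈ c, τ L.1 = L.2 := by
  classical
  refine ⟨Iᶜ.image fun i => (i, !a i), ⟨?_, ?_⟩, fun τ => ?_⟩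
  · rw [Finset.card_image_of_injective _ fun i j h => congrArg Prod.fst h, Finset.card_compl,
      Fintype.card_fin, hI]
    omega
  · simp only [Finset.mem_image]
    rintro _ ⟨i, -, rfl⟩ _ ⟨j, -, rfl⟩ (rfl : i = j)
    rfl
  · simp [cubeFace, Bool.eq_not]

theorem mem_thetaComplex_cube {n k : ℕ} {s : Finset (Fin n → Bool)} :
    s ∈ (thetaComplex (cubeHypergraph n k)).faces ↔ s.Nonempty ∧
      ∃ (I : Finset (Fin n)) (a : Fin n → Bool), I.card = k ∧ ∀ τ ∈ s, τ ∉ cubeFace I a := by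
  constructor
  · rintro ⟨hs, _, ⟨I, a, hI, rfl⟩, h⟩
    exact ⟨hs, I, a, hI, fun τ hτ => (h hτ).2⟩
  · rintro ⟨hs, I, a, hI, h⟩
    exact ⟨hs, _, ⟨I, a, hI, rfl⟩, fun τ hτ => ⟨Set.mem_univ _, h τ hτ⟩⟩

theorem mem_satComplex {ℓ n : ℕ} {s : Finset (SatFormula ℓ n)} :
    s ∈ (satComplex ℓ n).faces ↔ s.Nonempty ∧
      ∀ φ ∈ s, ∀ ψ ∈ s, φ.1.models ⊆ ψ.1.models ∨ ψ.1.models ⊆ φ.1.models := by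
  have : IsTrans (SatFormula ℓ n) (fun φ ψ => φ.1.Implies ψ.1) :=
    ⟨fun _ _ _ h₁ h₂ τ h => h₂ τ (h₁ τ h)⟩
  refine and_congr_right fun _ => ⟨?_, fun h => ?_⟩
  · rintro ⟨l, hl, hc⟩ φ hφ ψ hψ
    rw [List.isChain_iff_pairwise] at hc
    rw [← implies_iff_models_subset, ← implies_iff_models_subset]
    let R (φ ψ : SatFormula ℓ n) : Prop := φ.1.Implies ψ.1 ∨ ψ.1.Implies φ.1
    have : Std.Symm R := ⟨fun _ _ => Or.symm⟩
    have hR : l.Pairwise R := hc.imp Or.inl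
    exact List.Pairwise.forall_of_forall (R := R) (fun φ _ => Or.inl fun _ h => h) hR
      ((hl φ).2 hφ) ((hl ψ).2 hψ)
  -- Sorting needs a total relation, so formulae are sorted by number of models; for comparable
  -- model sets this order gives implication.
  · let r (φ ψ : SatFormula ℓ n) : Prop := φ.1.models.card ≤ ψ.1.models.card
    have : Std.Total r := ⟨fun _ _ => le_total _ _⟩
    have : IsTrans _ r := ⟨fun _ _ _ => le_trans⟩
    classical
    refine ⟨s.toList.insertionSort r, by simp, ?_⟩
    rw [List.isChain_iff_pairwise]
    refine (List.pairwise_insertionSort r s.toList).imp_of_mem fun {φ ψ} hφ hψ hr => ?_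
    rw [implies_iff_models_subset]
    refine (h φ (by simpa using hφ) ψ (by simpa using hψ)).elim id fun h => ?_
    exact (Finset.eq_of_subset_of_card_le h hr).ge

theorem mainTheorem1 (ℓ n : ℕ) (hℓn : ℓ ≤ n) :
    Nonempty
      (geometricRealization (satComplex ℓ n).toPreAbstractSimplicialComplex ≃ₕ
        geometricRealization (thetaComplex (cubeHypergraph n (n - ℓ)))) := by
  refine nonempty_homotopyEquiv_of_hull _ _ (fun φ => φ.1.models) (fun s => mem_satComplex)
    (fun φ => ?_) (fun σ => ⟨strongest ℓ σ.1, ⟨?_, ?_⟩, ?_⟩)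
    (fun σ τ h => models_strongest_mono ℓ h) (fun σ => subset_models_strongest ℓ σ.1)
    (fun φ => φ.2.1.models_strongest)
  · obtain ⟨φ, ⟨⟨c, hc⟩, hφ⟩, τ, hτ⟩ := φ
    obtain ⟨I, a, hI, h⟩ := exists_cubeFace_of_clause (hφ c hc).1 (hφ c hc).2
    exact mem_thetaComplex_cube.2
      ⟨⟨τ, mem_models.2 hτ⟩, I, a, hI, fun τ hτ => (h τ).2 (mem_models.1 hτ c hc)⟩
  -- The face that `σ` avoids supplies a clause true on `σ`, so the strongest formula is not the
  -- empty conjunction.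
  · obtain ⟨-, I, a, hI, h⟩ := mem_thetaComplex_cube.1 σ.2
    obtain ⟨c, hc, hcI⟩ := exists_clause_of_cubeFace hℓn hI a
    exact ⟨c, mem_strongest.2 ⟨hc, fun τ hτ => (hcI τ).1 (h τ hτ)⟩⟩
  · exact fun c hc => (mem_strongest.1 hc).1
  · obtain ⟨⟨τ, hτ⟩, -⟩ := mem_thetaComplex_cube.1 σ.2
    exact ⟨τ, mem_models.1 (subset_models_strongest ℓ _ hτ)⟩
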